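/- All graphs are finite and simple, and all matrices are real. For a graph $G$ of order $n$, $Z(G)$ denotes the zero forcing number: the minimum size of an initial set of blue vertices from which all vertices become blue by repeatedly letting a blue vertex with exactly one white neighbor color that neighbor blue. The skew zero forcing number $Z_-(G)$ is defined in the same way, except that any vertex, blue or white, with exactly one white neighbor may color that neighbor blue. $M_-(G)$ denotes the maximum nullity of a real skew-symmetric $n\times n$ matrix $B=[b_{ij}]$ such that $b_{ij}\neq 0$ if and only if $\{i,j\}$ is an edge of $G$. Two graphs are cospectral if their adjacency matrices have the same multiset of eigenvalues. $G\times K_r$ denotes the tensor product of $G$ with the complete graph $K_r$, in which $(u,i)$ and $(v,j)$ are adjacent if and only if $\{u,v\}$ is an edge of $G$ and $i\neq j$. **Proposition 3.3.** Let $G_1,G_2$ be cospectral graphs of order $n$ such that $Z_-(G_1)\neq Z_-(G_2)$ and $Z_-(G_i)=M_-(G_i)$ for $i=1,2$. Then for every integer $r\ge 4$ the graphs $G_1\times K_r$ and $G_2\times K_r$ are cospectral, $$Z(G_i\times K_r)=Z_-(G_i\times K_r)=(r-2)n+2Z_-(G_i)\qquad (i=1,2),$$ and hence $Z(G_1\times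 K_r)\neq Z(G_2\times K_r)$ and $Z_-(G_1\times K_r)\neq Z_-(G_2\times K_r)$. For distinct $r,s\ge 4$, no graph of the pair $(G_1\times K_r,\,G_2\times K_r)$ is isomorphic to a graph of the pair $(G_1\times K_s,\,G_2\times K_s)$. In particular, there are infinitely many $m$ for which there is a pair of cospectral graphs of order $m$ with different zero forcing numbers and different skew zero forcing numbers. -/

import Mathlib

/-- The tensor (direct, Kronecker) product `G × H` of two graphs: `(g, h)` and `(g', h')` are
adjacent iff `g ~ g'` in `G` and `h ~ h'` in `H`. -/
def tensorGraph {V W : Type*} (G : SimpleGraph V) (H : SimpleGraph W) : SimpleGraph (V × W) where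
  Adj p q := G.Adj p.1 q.1 ∧ H.Adj p.2 q.2
  symm := ⟨fun _ _ h => ⟨h.1.symm, h.2.symm⟩⟩
  loopless := ⟨fun _ h => h.1.ne rfl⟩

/-- One step of the standard colour change rule on the set of blue vertices: a blue vertex `u`
whose only white neighbour is `v` turns `v` blue. -/
def StdForce {V : Type*} (G : SimpleGraph V) (B B' : Set V) : Prop :=
  ∃ u v : V, u ∈ B ∧ {w | G.Adj u w ∧ w ∉ B} = {v} ∧ B' = insert v B

/-- One step of the skew colour change rule: any vertex `u`, blue or white, whose only white
neighbour is `v` turns `v` blue. -/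
def SkewForce {V : Type*} (G : SimpleGraph V) (B B' : Set V) : Prop :=
  ∃ u v : V, {w | G.Adj u w ∧ w ∉ B} = {v} ∧ B' = insert v B

/-- `S` is a zero forcing set: iterating the standard rule from `S` turns every vertex blue. -/
def IsZeroForcingSet {V : Type*} (G : SimpleGraph V) (S : Set V) : Prop :=
  Relation.ReflTransGen (StdForce G) S Set.univ

/-- `S` is a skew zero forcing set. -/
def IsSkewZeroForcingSet {V : Type*} (G : SimpleGraph V) (S : Set V) : Prop :=
  Relation.ReflTransGen (SkewForce G) S Set.univ

/-- The zero forcing number `Z(G)` of a finite graph (the set of all vertices is a zero forcing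
set, so the infimum is a minimum). -/
noncomputable def zeroForcingNumber {V : Type*} [Fintype V] (G : SimpleGraph V) : ℕ :=
  sInf {k | ∃ S : Set V, IsZeroForcingSet G S ∧ S.ncard = k}

/-- The skew zero forcing number `Z₋(G)` of a finite graph. -/
noncomputable def skewZeroForcingNumber {V : Type*} [Fintype V] (G : SimpleGraph V) : ℕ :=
  sInf {k | ∃ S : Set V, IsSkewZeroForcingSet G S ∧ S.ncard = k}

/-- The real skew-symmetric matrices whose graph is `G`. -/
def skewMatrices {V : Type*} (G : SimpleGraph V) : Set (Matrix V V ℝ) :=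
  {B | B.transpose = -B ∧ ∀ i j, B i j ≠ 0 ↔ G.Adj i j}

/-- The maximum skew nullity `M₋(G)`: the largest nullity of a real skew-symmetric matrix whose
graph is `G`. The set is non-empty and bounded by the order of `G`, so the supremum is a
maximum. -/
noncomputable def maxSkewNullity {V : Type*} [Fintype V] (G : SimpleGraph V) : ℕ :=
  sSup {k | ∃ B ∈ skewMatrices G, Module.finrank ℝ (LinearMap.ker B.mulVecLin) = k}

open Classical in
/-- The spectrum of the adjacency matrix: the multiset of its real eigenvalues, with
multiplicity. -/
noncomputable def adjSpectrum {V : Type*} [Fintype V] (G : SimpleGraph V) : Multiset ℝ :=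
  (G.adjMatrix ℝ).charpoly.roots

/-- Two graphs are cospectral (with respect to the adjacency matrix). -/
def AdjCospectral {V W : Type*} [Fintype V] [Fintype W] (G : SimpleGraph V) (H : SimpleGraph W) :
    Prop :=
  adjSpectrum G = adjSpectrum H

/-- The tensor product `G × K_r` with the complete graph on `r` vertices. -/
abbrev tensorComplete {V : Type*} (G : SimpleGraph V) (r : ℕ) : SimpleGraph (V × Fin r) :=
  tensorGraph G (⊤ : SimpleGraph (Fin r))

/-! The adjacency matrix of `G × K_r` is a Kronecker product, so its spectrum depends on `G` only
through the spectrum of `G`; this gives cospectrality. The forcing numbers are squeezed by `M₋(G) =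
Z₋(G)`. From below, tensor an optimal skew matrix of `G` with `(x i - x j)`, which has rank at most
2 and graph `K_r` when the `x i` are distinct: the nullity is at least `rn - 2(n - M₋(G))`, and
nullity bounds `Z₋` from below. From above, leave two copies of each white vertex of `G` white, in
layers `{0,1}` or `{2,3}`. If a forcing vertex and its target use opposite pairs, one skew force in
`G` becomes two standard forces, since the copies of the forcing vertex that act are blue even if it
is white in `G`. -/

/-! ### Spectra of tensor products. -/

section Spectrum

open Matrix Polynomial
open scoped Kronecker

theorem Matrix.charpoly_blockDiagonal {R m o : Type*} [CommRing R] [Fintype m] [DecidableEq m]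
    [Fintype o] [DecidableEq o] (M : o → Matrix m m R) :
    (blockDiagonal M).charpoly = ∏ k, (M k).charpoly := by
  have h : (blockDiagonal M).charmatrix = blockDiagonal fun k => (M k).charmatrix := by
    ext ⟨i, k⟩ ⟨j, l⟩
    by_cases hkl : k = l
    · subst hkl
      by_cases hij : i = j
      · subst hij; simp
      · simp [hij]
    · simp [blockDiagonal_apply, hkl]
  simp only [charpoly, h, det_blockDiagonal]

theorem Matrix.charpoly_diagonal_kronecker {R V W : Type*} [CommRing R] [Fintype V] [DecidableEq V]
    [Fintype W] [DecidableEq W] (d : V → R) (K : Matrix W W R) :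
    (diagonal d ⊗ₖ K).charpoly = ∏ i, (d i • K).charpoly := by
  rw [diagonal_kronecker, charpoly_reindex, charpoly_blockDiagonal]

/-- Conjugating by `U ⊗ 1`, with `U` diagonalizing `A`, leaves one block `t • K` per eigenvalue `t`.
-/
theorem Matrix.IsHermitian.charpoly_kronecker {V W : Type*} [Fintype V] [DecidableEq V] [Fintype W]
    [DecidableEq W] {A : Matrix V V ℝ} (hA : A.IsHermitian) (K : Matrix W W ℝ) :
    (A ⊗ₖ K).charpoly = (A.charpoly.roots.map fun t => (t • K).charpoly).prod := by
  have hd : (A ⊗ₖ K).charpoly = (diagonal hA.eigenvalues ⊗ₖ K).charpoly := by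
    set U : Matrix V V ℝ := (hA.eigenvectorUnitary : Matrix V V ℝ) with hU
    have hUU : star U * U = 1 := by simp [hU]
    have hs : A = U * diagonal hA.eigenvalues * star U := by
      conv_lhs => rw [hA.spectral_theorem, Unitary.conjStarAlgAut_apply]
      rfl
    have hk : A ⊗ₖ K =
        (U ⊗ₖ (1 : Matrix W W ℝ)) * ((diagonal hA.eigenvalues ⊗ₖ K) * (star U ⊗ₖ 1)) := by
      rw [← mul_kronecker_mul, ← mul_kronecker_mul, one_mul, mul_one, ← mul_assoc, ← hs]
    rw [hk, charpoly_mul_comm, mul_assoc, ← mul_kronecker_mul, hUU, one_mul, one_kronecker_one,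
      mul_one]
  rw [hd, charpoly_diagonal_kronecker, hA.roots_charpoly_eq_eigenvalues, Multiset.map_map]
  rfl

open Classical in
theorem adjMatrix_tensorGraph {V W : Type*} (G : SimpleGraph V) (H : SimpleGraph W) :
    (tensorGraph G H).adjMatrix ℝ = G.adjMatrix ℝ ⊗ₖ H.adjMatrix ℝ := by
  ext ⟨i, k⟩ ⟨j, l⟩
  have h : (tensorGraph G H).Adj (i, k) (j, l) ↔ G.Adj i j ∧ H.Adj k l := Iff.rfl
  by_cases h₁ : G.Adj i j <;> by_cases h₂ : H.Adj k l <;>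
    simp [SimpleGraph.adjMatrix_apply, h, h₁, h₂]

open Classical in
theorem adjSpectrum_tensorGraph {V W : Type*} [Fintype V] [Fintype W] (G : SimpleGraph V)
    (H : SimpleGraph W) : adjSpectrum (tensorGraph G H) =
      ((adjSpectrum G).map fun t => (t • H.adjMatrix ℝ).charpoly).prod.roots := by
  have hG : (G.adjMatrix ℝ).IsHermitian := by
    rw [Matrix.IsHermitian, conjTranspose_eq_transpose_of_trivial, SimpleGraph.transpose_adjMatrix]
  have h := hG.charpoly_kronecker (H.adjMatrix ℝ)
  rw [← adjMatrix_tensorGraph] at h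
  unfold adjSpectrum
  convert congrArg Polynomial.roots h

theorem AdjCospectral.tensorGraph {V₁ V₂ W : Type*} [Fintype V₁] [Fintype V₂] [Fintype W]
    {G₁ : SimpleGraph V₁} {G₂ : SimpleGraph V₂} (h : AdjCospectral G₁ G₂) (H : SimpleGraph W) :
    AdjCospectral (tensorGraph G₁ H) (tensorGraph G₂ H) := by
  unfold AdjCospectral at h ⊢
  rw [adjSpectrum_tensorGraph, adjSpectrum_tensorGraph, h]

theorem adjSpectrum_eq_of_iso {V W : Type*} [Fintype V] [Fintype W] {G : SimpleGraph V}
    {H : SimpleGraph W} (e : G ≃g H) : adjSpectrum G = adjSpectrum H := by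
  classical
  have h : H.adjMatrix ℝ = Matrix.reindex e.toEquiv e.toEquiv (G.adjMatrix ℝ) := by
    ext i j
    have := e.map_adj_iff (v := e.symm i) (w := e.symm j)
    simp only [RelIso.apply_symm_apply] at this
    simp only [SimpleGraph.adjMatrix_apply, Matrix.reindex_apply, Matrix.submatrix_apply, this]
    rfl
  unfold adjSpectrum
  have h₂ := congrArg Polynomial.roots (Matrix.charpoly_reindex e.toEquiv (G.adjMatrix ℝ))
  rw [← h] at h₂
  convert h₂.symm

end Spectrum

/-! ### Basic facts on forcing numbers. -/

section Forcing

theorem StdForce.skewForce {V : Type*} {G : SimpleGraph V} {B B' : Set V} (h : StdForce G B B') :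
    SkewForce G B B' := by
  obtain ⟨u, v, -, h₁, h₂⟩ := h
  exact ⟨u, v, h₁, h₂⟩

theorem IsZeroForcingSet.isSkewZeroForcingSet {V : Type*} {G : SimpleGraph V} {S : Set V}
    (h : IsZeroForcingSet G S) : IsSkewZeroForcingSet G S :=
  Relation.ReflTransGen.mono (fun _ _ => StdForce.skewForce) _ _ h

variable {V : Type*} [Fintype V] (G : SimpleGraph V)

theorem exists_zeroForcingSet_ncard_eq :
    ∃ S : Set V, IsZeroForcingSet G S ∧ S.ncard = zeroForcingNumber G :=
  Nat.sInf_mem (s := {k | ∃ S : Set V, IsZeroForcingSet G S ∧ S.ncard = k})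
    ⟨_, Set.univ, .refl, rfl⟩

theorem exists_skewZeroForcingSet_ncard_eq :
    ∃ S : Set V, IsSkewZeroForcingSet G S ∧ S.ncard = skewZeroForcingNumber G :=
  Nat.sInf_mem (s := {k | ∃ S : Set V, IsSkewZeroForcingSet G S ∧ S.ncard = k})
    ⟨_, Set.univ, .refl, rfl⟩

variable {G}

theorem IsZeroForcingSet.zeroForcingNumber_le {S : Set V} (h : IsZeroForcingSet G S) :
    zeroForcingNumber G ≤ S.ncard :=
  Nat.sInf_le ⟨S, h, rfl⟩

theorem IsSkewZeroForcingSet.skewZeroForcingNumber_le {S : Set V} (h : IsSkewZeroForcingSet G S) :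
    skewZeroForcingNumber G ≤ S.ncard :=
  Nat.sInf_le ⟨S, h, rfl⟩

variable (G)

theorem skewZeroForcingNumber_le_zeroForcingNumber :
    skewZeroForcingNumber G ≤ zeroForcingNumber G := by
  obtain ⟨S, hS, hc⟩ := exists_zeroForcingSet_ncard_eq G
  exact hc ▸ hS.isSkewZeroForcingSet.skewZeroForcingNumber_le

theorem skewZeroForcingNumber_le_card : skewZeroForcingNumber G ≤ Fintype.card V := by
  have h : IsSkewZeroForcingSet G Set.univ := .refl
  simpa [Set.ncard_univ] using h.skewZeroForcingNumber_le

end Forcing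

/-! ### Invariance under isomorphism. -/

section Iso

variable {V W : Type*} {G : SimpleGraph V} {H : SimpleGraph W}

theorem image_whiteNeighbors (e : G ≃g H) (B : Set V) (u : V) :
    {w | H.Adj (e u) w ∧ w ∉ e '' B} = e '' {w | G.Adj u w ∧ w ∉ B} := by
  ext w
  obtain ⟨w, rfl⟩ := e.surjective w
  rw [e.injective.mem_set_image]
  exact and_congr e.map_adj_iff (not_congr e.injective.mem_set_image)

theorem SkewForce.image (e : G ≃g H) {B B' : Set V} (h : SkewForce G B B') :
    SkewForce H (e '' B) (e '' B') := by
  obtain ⟨u, v, h₁, rfl⟩ := h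
  exact ⟨e u, e v, by rw [image_whiteNeighbors, h₁, Set.image_singleton], Set.image_insert_eq⟩

theorem StdForce.image (e : G ≃g H) {B B' : Set V} (h : StdForce G B B') :
    StdForce H (e '' B) (e '' B') := by
  obtain ⟨u, v, h₀, h₁, rfl⟩ := h
  exact ⟨e u, e v, Set.mem_image_of_mem _ h₀,
    by rw [image_whiteNeighbors, h₁, Set.image_singleton], Set.image_insert_eq⟩

theorem IsZeroForcingSet.image (e : G ≃g H) {S : Set V} (h : IsZeroForcingSet G S) :
    IsZeroForcingSet H (e '' S) := by
  have h' := Relation.ReflTransGen.lift (p := StdForce H) (e '' ·) (fun _ _ => StdForce.image e) _ _ h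
  rwa [Function.onFun, Set.image_univ, e.surjective.range_eq] at h'

theorem IsSkewZeroForcingSet.image (e : G ≃g H) {S : Set V} (h : IsSkewZeroForcingSet G S) :
    IsSkewZeroForcingSet H (e '' S) := by
  have h' := Relation.ReflTransGen.lift (p := SkewForce H) (e '' ·) (fun _ _ => SkewForce.image e) _ _ h
  rwa [Function.onFun, Set.image_univ, e.surjective.range_eq] at h'

variable [Fintype V] [Fintype W]

theorem zeroForcingNumber_le_of_iso (e : G ≃g H) : zeroForcingNumber H ≤ zeroForcingNumber G := by
  obtain ⟨S, hS, hc⟩ := exists_zeroForcingSet_ncard_eq G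
  rw [← hc, ← Set.ncard_image_of_injective S e.injective]
  exact (hS.image e).zeroForcingNumber_le

theorem skewZeroForcingNumber_le_of_iso (e : G ≃g H) :
    skewZeroForcingNumber H ≤ skewZeroForcingNumber G := by
  obtain ⟨S, hS, hc⟩ := exists_skewZeroForcingSet_ncard_eq G
  rw [← hc, ← Set.ncard_image_of_injective S e.injective]
  exact (hS.image e).skewZeroForcingNumber_le

theorem zeroForcingNumber_eq_of_iso (e : G ≃g H) : zeroForcingNumber G = zeroForcingNumber H :=
  le_antisymm (zeroForcingNumber_le_of_iso e.symm) (zeroForcingNumber_le_of_iso e)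

theorem skewZeroForcingNumber_eq_of_iso (e : G ≃g H) :
    skewZeroForcingNumber G = skewZeroForcingNumber H :=
  le_antisymm (skewZeroForcingNumber_le_of_iso e.symm) (skewZeroForcingNumber_le_of_iso e)

end Iso

/-! ### Lower bound by nullity. -/

section LowerBound

open Matrix
open scoped Kronecker

variable {V : Type*} [Fintype V] {G : SimpleGraph V}

/-- A kernel vector of a matrix with graph `G` that vanishes on a skew zero forcing set is zero. -/
theorem IsSkewZeroForcingSet.eq_zero_of_mulVec_eq_zero {A : Matrix V V ℝ}
    (hA : ∀ i j, A i j ≠ 0 ↔ G.Adj i j) {S : Set V} (hS : IsSkewZeroForcingSet G S) {x : V → ℝ}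
    (hx : A *ᵥ x = 0) (h₀ : ∀ v ∈ S, x v = 0) : x = 0 := by
  suffices h : ∀ T, Relation.ReflTransGen (SkewForce G) S T → ∀ v ∈ T, x v = 0 from
    funext fun v => h _ hS v trivial
  intro T hT
  induction hT with
  | refl => exact h₀
  | tail _ hstep ih =>
    obtain ⟨u, v, huv, rfl⟩ := hstep
    rintro w (rfl | hw)
    · have hmem : w ∈ {w' | G.Adj u w' ∧ w' ∉ _} := huv ▸ Set.mem_singleton w
      have hu : ∑ j, A u j * x j = 0 := congrFun hx u
      -- Only the term at `w` survives: the other neighbours of `u` are blue, and `A u u = 0`, so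
      -- `u` itself may be white.
      rw [Finset.sum_eq_single w] at hu
      · exact (mul_eq_zero.mp hu).resolve_left ((hA _ _).mpr hmem.1)
      · intro j _ hj
        by_contra hne
        have hne' := mul_ne_zero_iff.mp hne
        have : j ∈ ({w} : Set V) :=
          huv ▸ ⟨(hA _ _).mp hne'.1, fun hjB => hne'.2 (ih j hjB)⟩
        exact hj this
      · simp
    · exact ih w hw

/-- Restricting kernel vectors to a minimum skew zero forcing set is injective. -/
theorem finrank_ker_mulVecLin_le_skewZeroForcingNumber {A : Matrix V V ℝ}
    (hA : ∀ i j, A i j ≠ 0 ↔ G.Adj i j) :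
    Module.finrank ℝ (LinearMap.ker A.mulVecLin) ≤ skewZeroForcingNumber G := by
  classical
  obtain ⟨S, hS, hc⟩ := exists_skewZeroForcingSet_ncard_eq G
  let f : LinearMap.ker A.mulVecLin →ₗ[ℝ] (S → ℝ) :=
    LinearMap.funLeft ℝ ℝ (Subtype.val : S → V) ∘ₗ Submodule.subtype _
  have hf : Function.Injective f := by
    rw [injective_iff_map_eq_zero]
    intro x hx
    apply Subtype.ext
    exact hS.eq_zero_of_mulVec_eq_zero hA (LinearMap.mem_ker.mp x.2) fun v hv => congrFun hx ⟨v, hv⟩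
  have h := LinearMap.finrank_le_finrank_of_injective hf
  rwa [Module.finrank_fintype_fun_eq_card, ← Nat.card_eq_fintype_card, Nat.card_coe_set_eq, hc] at h

theorem skewMatrices_nonempty (G : SimpleGraph V) : (skewMatrices G).Nonempty := by
  classical
  let e := Fintype.equivFin V
  refine ⟨Matrix.of fun i j => if G.Adj i j then ((e i : ℕ) : ℝ) - (e j : ℕ) else 0, ?_, ?_⟩
  · ext i j
    by_cases h : G.Adj i j <;> simp [h, G.adj_comm j i]
  · intro i j
    by_cases h : G.Adj i j
    · have : (e i : ℕ) ≠ e j := fun h' => h.ne (e.injective (Fin.ext h'))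
      simpa [h, sub_eq_zero] using this
    · simp [h]

theorem exists_skewMatrix_finrank_ker_eq (G : SimpleGraph V) : ∃ B ∈ skewMatrices G,
    Module.finrank ℝ (LinearMap.ker B.mulVecLin) = maxSkewNullity G := by
  obtain ⟨B, hB⟩ := skewMatrices_nonempty G
  refine Nat.sSup_mem (s := {k | ∃ B ∈ skewMatrices G,
    Module.finrank ℝ (LinearMap.ker B.mulVecLin) = k}) ⟨_, B, hB, rfl⟩ ⟨skewZeroForcingNumber G, ?_⟩
  rintro k ⟨B, hB, rfl⟩
  exact finrank_ker_mulVecLin_le_skewZeroForcingNumber hB.2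

/-- The Kronecker product with the matrix `(x i - x j)` at most doubles the rank. -/
theorem rank_kronecker_sub_le {W : Type*} [Fintype W] (B : Matrix V V ℝ) (x : W → ℝ) :
    (B ⊗ₖ Matrix.of fun i j => x i - x j).rank ≤ 2 * B.rank := by
  let R := LinearMap.range B.mulVecLin
  -- Since `x i - x j = x i * 1 - 1 * x j`, every value of the product has the form `x i * a v - b
  -- v` with `a`, `b` in the range of `B`.
  let f : (R × R) →ₗ[ℝ] (V × W → ℝ) :=
    { toFun := fun y p => x p.2 * (y.1 : V → ℝ) p.1 - (y.2 : V → ℝ) p.1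
      map_add' := by intro a b; ext p; simp; ring
      map_smul' := by intro c a; ext p; simp; ring }
  have hle : LinearMap.range (B ⊗ₖ Matrix.of fun i j => x i - x j).mulVecLin ≤
      LinearMap.range f := by
    rintro _ ⟨y, rfl⟩
    refine ⟨⟨⟨B *ᵥ fun v => ∑ j, y (v, j), ⟨_, rfl⟩⟩,
      ⟨B *ᵥ fun v => ∑ j, x j * y (v, j), ⟨_, rfl⟩⟩⟩, ?_⟩
    ext ⟨v, i⟩
    simp only [f, LinearMap.coe_mk, AddHom.coe_mk, mulVecLin_apply, mulVec, dotProduct,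
      Fintype.sum_prod_type, kroneckerMap_apply, of_apply, Finset.mul_sum, ← Finset.sum_sub_distrib]
    refine Finset.sum_congr rfl fun w _ => Finset.sum_congr rfl fun j _ => ?_
    ring
  calc (B ⊗ₖ Matrix.of fun i j => x i - x j).rank ≤ Module.finrank ℝ (LinearMap.range f) :=
        Submodule.finrank_mono hle
    _ ≤ Module.finrank ℝ (R × R) := LinearMap.finrank_range_le f
    _ = 2 * B.rank := by rw [Module.finrank_prod, ← two_mul]; rfl

theorem finrank_ker_mulVecLin_add_rank {m : Type*} [Fintype m] (A : Matrix m m ℝ) :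
    Module.finrank ℝ (LinearMap.ker A.mulVecLin) + A.rank = Fintype.card m := by
  have h := LinearMap.finrank_range_add_finrank_ker A.mulVecLin
  rw [Module.finrank_fintype_fun_eq_card] at h
  rw [← h, add_comm]
  rfl

theorem le_skewZeroForcingNumber_tensorComplete (G : SimpleGraph V) {r : ℕ} (hr : 2 ≤ r) :
    (r - 2) * Fintype.card V + 2 * maxSkewNullity G ≤
      skewZeroForcingNumber (tensorComplete G r) := by
  obtain ⟨B, hB, hk⟩ := exists_skewMatrix_finrank_ker_eq G
  -- Distinct values make `x i - x j` vanish exactly on the diagonal.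
  let x : Fin r → ℝ := fun i => (i : ℕ)
  have hpat : ∀ p q, (B ⊗ₖ Matrix.of fun i j => x i - x j) p q ≠ 0 ↔
      (tensorComplete G r).Adj p q := by
    rintro ⟨u, i⟩ ⟨v, j⟩
    rw [kroneckerMap_apply, mul_ne_zero_iff, hB.2]
    simp [tensorGraph, x, sub_eq_zero, Fin.ext_iff]
  have h₁ := finrank_ker_mulVecLin_le_skewZeroForcingNumber hpat
  have h₂ := finrank_ker_mulVecLin_add_rank (B ⊗ₖ Matrix.of fun i j => x i - x j)
  have h₃ := rank_kronecker_sub_le B x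
  have h₄ := finrank_ker_mulVecLin_add_rank B
  rw [Fintype.card_prod, Fintype.card_fin] at h₂
  obtain ⟨s, rfl⟩ := Nat.exists_eq_add_of_le' hr
  rw [Nat.add_sub_cancel]
  nlinarith

end LowerBound

/-! ### Upper bound by lifting skew forces. -/

section UpperBound

variable {V : Type*} {G : SimpleGraph V} {r : ℕ}

/-- The layers of `G × K_r` left white above a white vertex of colour `b`: the first two or the
next two. -/
def whiteLayers (r : ℕ) (b : Bool) : Set (Fin r) :=
  {i | if b then (i : ℕ) = 0 ∨ (i : ℕ) = 1 else (i : ℕ) = 2 ∨ (i : ℕ) = 3}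

/-- The blue set of `G × K_r` obtained from a blue set `B` of `G` and a colouring `c`. -/
def liftedBlue (r : ℕ) (c : V → Bool) (B : Set V) : Set (V × Fin r) :=
  {p | p.1 ∈ B ∨ p.2 ∉ whiteLayers r (c p.1)}

/-- Two disjoint pairs of layers are needed, hence `4 ≤ r`. -/
theorem exists_whiteLayers_eq_pair (hr : 4 ≤ r) (b : Bool) :
    ∃ i j : Fin r, i ≠ j ∧ whiteLayers r b = {i, j} ∧
      i ∉ whiteLayers r (!b) ∧ j ∉ whiteLayers r (!b) := by
  cases b
  · refine ⟨⟨2, by omega⟩, ⟨3, by omega⟩, by simp, ?_, by simp [whiteLayers], by simp [whiteLayers]⟩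
    ext i
    simp [whiteLayers, Fin.ext_iff]
  · refine ⟨⟨0, by omega⟩, ⟨1, by omega⟩, by simp, ?_, by simp [whiteLayers], by simp [whiteLayers]⟩
    ext i
    simp [whiteLayers, Fin.ext_iff]

/-- If the white neighbour `v` of `u` has the opposite colour, a skew force `u → v` in `G` lifts to
two standard forces in `G × K_r`. -/
theorem reflTransGen_stdForce_liftedBlue (hr : 4 ≤ r) {B : Set V} {u v : V}
    (huv : {w | G.Adj u w ∧ w ∉ B} = {v}) {c : V → Bool} (hc : c u = !c v) :
    Relation.ReflTransGen (StdForce (tensorComplete G r)) (liftedBlue r c B)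
      (liftedBlue r c (insert v B)) := by
  obtain ⟨i, j, hij, hpair, hi, hj⟩ := exists_whiteLayers_eq_pair hr (c v)
  have hw : ∀ w, (G.Adj u w ∧ w ∉ B) ↔ w = v := fun w => Set.ext_iff.mp huv w
  have hmem : ∀ l, l ∈ whiteLayers r (c v) ↔ l = i ∨ l = j := fun l => Set.ext_iff.mp hpair l
  have hv := (hw v).mpr rfl
  -- `(u, i)` is blue by the opposite colour and not adjacent to `(v, i)`, so `(v, j)` is its only
  -- white neighbour; `(u, j)` then forces `(v, i)`.
  have hfirst : StdForce (tensorComplete G r) (liftedBlue r c B)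
      (insert (v, j) (liftedBlue r c B)) := by
    refine ⟨(u, i), (v, j), Or.inr (hc ▸ hi), ?_, rfl⟩
    ext ⟨w, l⟩
    simp only [liftedBlue, tensorGraph, Set.mem_ofPred_eq, SimpleGraph.top_adj,
      Set.mem_singleton_iff, Prod.mk.injEq, not_or, not_not]
    constructor
    · rintro ⟨⟨h₁, h₂⟩, h₃, h₄⟩
      obtain rfl := (hw w).mp ⟨h₁, h₃⟩
      exact ⟨rfl, ((hmem l).mp h₄).resolve_left h₂.symm⟩
    · rintro ⟨rfl, rfl⟩
      exact ⟨⟨hv.1, hij⟩, hv.2, (hmem _).mpr (Or.inr rfl)⟩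
  have hsecond : StdForce (tensorComplete G r) (insert (v, j) (liftedBlue r c B))
      (liftedBlue r c (insert v B)) := by
    refine ⟨(u, j), (v, i), Or.inr (Or.inr (hc ▸ hj)), ?_, ?_⟩
    · ext ⟨w, l⟩
      simp only [liftedBlue, tensorGraph, Set.mem_ofPred_eq, SimpleGraph.top_adj,
        Set.mem_singleton_iff, Set.mem_insert_iff, Prod.mk.injEq, not_or, not_not]
      constructor
      · rintro ⟨⟨h₁, h₂⟩, -, h₃, h₄⟩
        obtain rfl := (hw w).mp ⟨h₁, h₃⟩
        exact ⟨rfl, ((hmem l).mp h₄).resolve_right h₂.symm⟩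
      · rintro ⟨rfl, rfl⟩
        exact ⟨⟨hv.1, hij.symm⟩, fun h => hij h.2, hv.2, (hmem _).mpr (Or.inl rfl)⟩
    · ext ⟨w, l⟩
      simp only [liftedBlue, Set.mem_ofPred_eq, Set.mem_insert_iff, Prod.mk.injEq]
      by_cases h : w = v
      · subst h
        have := hmem l
        tauto
      · simp [h]
  exact (Relation.ReflTransGen.single hfirst).tail hsecond

/-- The colouring is built backwards from the last force: once `v` is blue its colour is irrelevant,
so it can be set opposite to that of the vertex forcing it. -/
theorem IsSkewZeroForcingSet.exists_isZeroForcingSet_liftedBlue (hr : 4 ≤ r) {S : Set V}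
    (hS : IsSkewZeroForcingSet G S) :
    ∃ c : V → Bool, IsZeroForcingSet (tensorComplete G r) (liftedBlue r c S) := by
  classical
  unfold IsSkewZeroForcingSet at hS
  induction hS using Relation.ReflTransGen.head_induction_on with
  | refl =>
    refine ⟨fun _ => true, ?_⟩
    have : liftedBlue r (fun _ : V => true) Set.univ = Set.univ := by ext; simp [liftedBlue]
    rw [this]
    exact .refl
  | head hstep _ ih =>
    obtain ⟨u, v, huv, rfl⟩ := hstep
    obtain ⟨c, hc⟩ := ih
    have hne : u ≠ v := by
      have : v ∈ {w | G.Adj u w ∧ w ∉ _} := huv ▸ Set.mem_singleton v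
      exact this.1.ne
    refine ⟨Function.update c v (!c u), ?_⟩
    have heq : ∀ B : Set V, liftedBlue r (Function.update c v (!c u)) (insert v B) =
        liftedBlue r c (insert v B) := by
      intro B
      ext ⟨w, l⟩
      by_cases h : w = v
      · simp [liftedBlue, h]
      · simp [liftedBlue, h]
    have hlift := reflTransGen_stdForce_liftedBlue (c := Function.update c v (!c u)) hr huv
      (by simp [hne])
    rw [heq] at hlift
    exact hlift.trans hc

theorem ncard_liftedBlue [Fintype V] (hr : 4 ≤ r) (c : V → Bool) (S : Set V) :
    (liftedBlue r c S).ncard = (r - 2) * Fintype.card V + 2 * S.ncard := by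
  classical
  -- Each white vertex of `G` contributes exactly two white copies.
  have hcompl : (liftedBlue r c S)ᶜ.ncard = 2 * Sᶜ.ncard := by
    choose i j hij hpair _ _ using fun b => exists_whiteLayers_eq_pair hr b
    have : (liftedBlue r c S)ᶜ =
        (fun v => (v, i (c v))) '' Sᶜ ∪ (fun v => (v, j (c v))) '' Sᶜ := by
      ext ⟨w, l⟩
      have := Set.ext_iff.mp (hpair (c w)) l
      simp only [Set.mem_insert_iff, Set.mem_singleton_iff] at this
      simp only [liftedBlue, Set.mem_compl_iff, Set.mem_ofPred_eq, not_or, this,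
        Set.mem_union, Set.mem_image, Prod.mk.injEq]
      grind
    rw [this, Set.ncard_union_eq, Set.ncard_image_of_injective, Set.ncard_image_of_injective,
      two_mul]
    · exact fun a b h => congrArg Prod.fst h
    · exact fun a b h => congrArg Prod.fst h
    · rw [Set.disjoint_left]
      rintro _ ⟨a, -, rfl⟩ ⟨b, -, h⟩
      simp only [Prod.mk.injEq] at h
      obtain ⟨rfl, h⟩ := h
      exact hij _ h.symm
  have h₁ := Set.ncard_add_ncard_compl (liftedBlue r c S)
  have h₂ := Set.ncard_add_ncard_compl S
  rw [Nat.card_eq_fintype_card] at h₁ h₂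
  rw [Fintype.card_prod, Fintype.card_fin] at h₁
  obtain ⟨s, rfl⟩ := Nat.exists_eq_add_of_le' (show 2 ≤ r by omega)
  rw [Nat.add_sub_cancel]
  nlinarith

theorem zeroForcingNumber_tensorComplete_le [Fintype V] (G : SimpleGraph V) (hr : 4 ≤ r) :
    zeroForcingNumber (tensorComplete G r) ≤
      (r - 2) * Fintype.card V + 2 * skewZeroForcingNumber G := by
  obtain ⟨S, hS, hc⟩ := exists_skewZeroForcingSet_ncard_eq G
  obtain ⟨c, hz⟩ := hS.exists_isZeroForcingSet_liftedBlue hr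
  rw [← hc, ← ncard_liftedBlue hr c S]
  exact hz.zeroForcingNumber_le

end UpperBound

/-! ### The exact values and the conclusion. -/

theorem forcingNumbers_tensorComplete {V : Type*} [Fintype V] {G : SimpleGraph V}
    (hM : skewZeroForcingNumber G = maxSkewNullity G) {r : ℕ} (hr : 4 ≤ r) :
    zeroForcingNumber (tensorComplete G r) =
        (r - 2) * Fintype.card V + 2 * skewZeroForcingNumber G ∧
      skewZeroForcingNumber (tensorComplete G r) =
        (r - 2) * Fintype.card V + 2 * skewZeroForcingNumber G := by
  have h₁ := zeroForcingNumber_tensorComplete_le G hr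
  have h₂ := le_skewZeroForcingNumber_tensorComplete G (r := r) (by omega)
  have h₃ := skewZeroForcingNumber_le_zeroForcingNumber (tensorComplete G r)
  rw [← hM] at h₂
  omega

theorem isEmpty_tensorComplete_iso {V W : Type*} [Fintype V] [Fintype W]
    (h : Fintype.card V = Fintype.card W) (hV : Fintype.card V ≠ 0) (G : SimpleGraph V)
    (H : SimpleGraph W) {r s : ℕ} (hrs : r ≠ s) :
    IsEmpty (tensorComplete G r ≃g tensorComplete H s) := by
  refine ⟨fun e => hrs ?_⟩
  have := Fintype.card_congr e.toEquiv
  rw [Fintype.card_prod, Fintype.card_prod, Fintype.card_fin, Fintype.card_fin, ← h] at this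
  exact Nat.eq_of_mul_eq_mul_left (Nat.pos_of_ne_zero hV) this

theorem proposition3p3 {V₁ V₂ : Type*} [Fintype V₁] [Fintype V₂] (n : ℕ)
    (hV₁ : Fintype.card V₁ = n) (hV₂ : Fintype.card V₂ = n)
    (G₁ : SimpleGraph V₁) (G₂ : SimpleGraph V₂)
    (hspec : AdjCospectral G₁ G₂)
    (hne : skewZeroForcingNumber G₁ ≠ skewZeroForcingNumber G₂)
    (hM₁ : skewZeroForcingNumber G₁ = maxSkewNullity G₁)
    (hM₂ : skewZeroForcingNumber G₂ = maxSkewNullity G₂) :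
    -- the pairs `G₁ × K_r`, `G₂ × K_r`
    (∀ r : ℕ, 4 ≤ r →
      AdjCospectral (tensorComplete G₁ r) (tensorComplete G₂ r) ∧
      zeroForcingNumber (tensorComplete G₁ r) = (r - 2) * n + 2 * skewZeroForcingNumber G₁ ∧
      skewZeroForcingNumber (tensorComplete G₁ r) = (r - 2) * n + 2 * skewZeroForcingNumber G₁ ∧
      zeroForcingNumber (tensorComplete G₂ r) = (r - 2) * n + 2 * skewZeroForcingNumber G₂ ∧
      skewZeroForcingNumber (tensorComplete G₂ r) = (r - 2) * n + 2 * skewZeroForcingNumber G₂ ∧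
      zeroForcingNumber (tensorComplete G₁ r) ≠ zeroForcingNumber (tensorComplete G₂ r) ∧
      skewZeroForcingNumber (tensorComplete G₁ r) ≠
        skewZeroForcingNumber (tensorComplete G₂ r)) ∧
    -- pairs for different `r` have no graph in common, up to isomorphism
    (∀ r s : ℕ, 4 ≤ r → 4 ≤ s → r ≠ s →
      IsEmpty (tensorComplete G₁ r ≃g tensorComplete G₁ s) ∧
      IsEmpty (tensorComplete G₁ r ≃g tensorComplete G₂ s) ∧
      IsEmpty (tensorComplete G₂ r ≃g tensorComplete G₂ s)) ∧
    -- hence there are such pairs of infinitely many different orders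
    {m : ℕ | ∃ H₁ H₂ : SimpleGraph (Fin m), AdjCospectral H₁ H₂ ∧
      zeroForcingNumber H₁ ≠ zeroForcingNumber H₂ ∧
      skewZeroForcingNumber H₁ ≠ skewZeroForcingNumber H₂}.Infinite := by
  -- For `n = 0` both skew forcing numbers would be 0, against `hne`.
  have hn : n ≠ 0 := by
    rintro rfl
    have h₁ := skewZeroForcingNumber_le_card G₁
    have h₂ := skewZeroForcingNumber_le_card G₂
    omega
  have hprod : ∀ r : ℕ, 4 ≤ r →
      AdjCospectral (tensorComplete G₁ r) (tensorComplete G₂ r) ∧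
      zeroForcingNumber (tensorComplete G₁ r) = (r - 2) * n + 2 * skewZeroForcingNumber G₁ ∧
      skewZeroForcingNumber (tensorComplete G₁ r) = (r - 2) * n + 2 * skewZeroForcingNumber G₁ ∧
      zeroForcingNumber (tensorComplete G₂ r) = (r - 2) * n + 2 * skewZeroForcingNumber G₂ ∧
      skewZeroForcingNumber (tensorComplete G₂ r) = (r - 2) * n + 2 * skewZeroForcingNumber G₂ ∧
      zeroForcingNumber (tensorComplete G₁ r) ≠ zeroForcingNumber (tensorComplete G₂ r) ∧
      skewZeroForcingNumber (tensorComplete G₁ r) ≠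
        skewZeroForcingNumber (tensorComplete G₂ r) := by
    intro r hr
    obtain ⟨h₁, h₁'⟩ := forcingNumbers_tensorComplete hM₁ hr
    obtain ⟨h₂, h₂'⟩ := forcingNumbers_tensorComplete hM₂ hr
    rw [hV₁] at h₁ h₁'
    rw [hV₂] at h₂ h₂'
    exact ⟨hspec.tensorGraph ⊤, h₁, h₁', h₂, h₂', by omega, by omega⟩
  refine ⟨hprod, fun r s _ _ hrs => ⟨isEmpty_tensorComplete_iso rfl (hV₁ ▸ hn) _ _ hrs,
    isEmpty_tensorComplete_iso (hV₁.trans hV₂.symm) (hV₁ ▸ hn) _ _ hrs,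
    isEmpty_tensorComplete_iso rfl (hV₂ ▸ hn) _ _ hrs⟩, ?_⟩
  refine Set.infinite_of_injective_forall_mem (f := fun k : ℕ => n * (k + 4)) ?_ fun k => ?_
  · intro a b h
    have := Nat.eq_of_mul_eq_mul_left (Nat.pos_of_ne_zero hn) h
    omega
  · obtain ⟨hs, -, -, -, -, hz, hz'⟩ := hprod (k + 4) (by omega)
    let e₁ : V₁ × Fin (k + 4) ≃ Fin (n * (k + 4)) := Fintype.equivFinOfCardEq (by simp [hV₁])
    let e₂ : V₂ × Fin (k + 4) ≃ Fin (n * (k + 4)) := Fintype.equivFinOfCardEq (by simp [hV₂])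
    have i₁ := SimpleGraph.Iso.map e₁ (tensorComplete G₁ (k + 4))
    have i₂ := SimpleGraph.Iso.map e₂ (tensorComplete G₂ (k + 4))
    refine ⟨(tensorComplete G₁ (k + 4)).map e₁, (tensorComplete G₂ (k + 4)).map e₂, ?_, ?_, ?_⟩
    rotate_left
    · rwa [zeroForcingNumber_eq_of_iso i₁, zeroForcingNumber_eq_of_iso i₂] at hz
    · rwa [skewZeroForcingNumber_eq_of_iso i₁, skewZeroForcingNumber_eq_of_iso i₂] at hz'
    · rwa [AdjCospectral, adjSpectrum_eq_of_iso i₁, adjSpectrum_eq_of_iso i₂] at hs
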